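/- Let $(\mathbb{S},d)$ be a complete separable metric space with its Borel $\sigma$-field, let $\mathbb{C}\subset\mathbb{S}$ be closed, and put $\mathbb{O}=\mathbb{S}\setminus\mathbb{C}$ and $\mathbb{C}^r=\{x\in\mathbb{S}: d(x,\mathbb{C})<r\}$ for $r>0$ (with $d(x,\emptyset)=\infty$). Let $\mathcal{C}_{\mathbb{O}}$ be the set of non-negative bounded continuous functions $f:\mathbb{O}\to\mathbb{R}$ that vanish on $\mathbb{C}^r\cap\mathbb{O}$ for some $r>0$. Let $\mathbb{M}_{\mathbb{O}}$ be the space of Borel measures $\mu$ on $\mathbb{O}$ with $\mu(\mathbb{S}\setminus\mathbb{C}^r)<\infty$ for every $r>0$, with the coarsest topology for which $\mu\mapsto\int f\,d\mu$ is continuous for every $f\in\mathcal{C}_{\mathbb{O}}$; thus $\mu_n\to\mu$ in $\mathbb{M}_{\mathbb{O}}$ if and only if $\int f\,d\mu_n\to\int f\,d\mu$ for all $f\in\mathcal{C}_{\mathbb{O}}$. Let $\mathbb{N}_{\mathbb{O}}$ be the set of counting measures, that is, of all $N\in\mathbb{M}_{\mathbb{O}}$ such that for every $r>0$ and every Borel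 set $A\subset\mathbb{S}$ the value $N(A\setminus\mathbb{C}^r)$ is a non-negative integer. Then $\mathbb{N}_{\mathbb{O}}$ is a closed subset of $\mathbb{M}_{\mathbb{O}}$. -/

import Mathlib

open MeasureTheory Topology Filter
open scoped BoundedContinuousFunction

/-- The part of `𝕆 = 𝕊 \ ℂ` at distance at least `r` from `ℂ`, as a subset of `𝕆 = ↥Cᶜ`.
`Metric.thickening r C` is the set `ℂ^r` of points of `𝕊` at distance `< r` from `ℂ`
(it is empty when `ℂ` is empty, so `d(x, ∅) = ∞`). -/
def awaySet {S : Type*} [MetricSpace S] (C : Set S) (r : ℝ) : Set ↥(Cᶜ) :=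
  {x | (x : S) ∉ Metric.thickening r C}

/-- The class `𝒞_𝕆`: non-negative bounded continuous real functions on `𝕆` that vanish
on `ℂ^r` for some `r > 0`. -/
def testFunctions {S : Type*} [MetricSpace S] (C : Set S) : Set (↥(Cᶜ) →ᵇ ℝ) :=
  {f | (∀ x, 0 ≤ f x) ∧ ∃ r : ℝ, 0 < r ∧ ∀ x : ↥(Cᶜ), (x : S) ∈ Metric.thickening r C → f x = 0}

/-- The space `𝕄_𝕆` of Borel measures on `𝕆` that are finite on the complement of `ℂ^r`
for every `r > 0`. -/
def MO {S : Type*} [MetricSpace S] [MeasurableSpace S] (C : Set S) : Type _ :=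
  {μ : Measure ↥(Cᶜ) // ∀ r : ℝ, 0 < r → μ (awaySet C r) < ⊤}

/-- The topology of `𝕄_𝕆`, whose basic neighbourhoods of `μ` are
`{υ | |∫ fᵢ dυ - ∫ fᵢ dμ| < ε, i = 1, …, k}` with `fᵢ ∈ 𝒞_𝕆`: the coarsest topology making
`μ ↦ ∫ f dμ` continuous for every `f ∈ 𝒞_𝕆`. -/
noncomputable instance instTopologicalSpaceMO {S : Type*} [MetricSpace S] [MeasurableSpace S] (C : Set S) :
    TopologicalSpace (MO C) :=
  TopologicalSpace.induced
    (fun (μ : MO C) (f : testFunctions C) => ∫ x, (f : ↥(Cᶜ) →ᵇ ℝ) x ∂μ.1) inferInstance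

/-- Convergence in `𝕄_𝕆` is convergence of the integrals of all `f ∈ 𝒞_𝕆`. -/
theorem MO.tendsto_iff {S : Type*} [MetricSpace S] [MeasurableSpace S] {C : Set S}
    {ι : Type*} {l : Filter ι} {u : ι → MO C} {μ : MO C} :
    Tendsto u l (𝓝 μ) ↔
      ∀ f ∈ testFunctions C, Tendsto (fun i => ∫ x, f x ∂(u i).1) l (𝓝 (∫ x, f x ∂μ.1)) := by
  rw [nhds_induced, tendsto_comap_iff, tendsto_pi_nhds]
  exact ⟨fun h f hf => h ⟨f, hf⟩, fun h f => h f.1 f.2⟩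

/-- The set `ℕ_𝕆` of counting measures: those `N ∈ 𝕄_𝕆` such that `N (A \ ℂ^r)` is a
non-negative integer for every `r > 0` and every Borel set `A` of `𝕊`. -/
def NO {S : Type*} [MetricSpace S] [MeasurableSpace S] (C : Set S) : Set (MO C) :=
  {N | ∀ r : ℝ, 0 < r → ∀ A : Set S, MeasurableSet A →
    ∃ n : ℕ, N.1 {x : ↥(Cᶜ) | (x : S) ∈ A \ Metric.thickening r C} = n}

/-! Integrality means that no value lies strictly between consecutive integers `n` and `n + 1`, and
such a strict inclusion passes from a limit `μ` to nearby counting measures. If `n < μ F < n + 1`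
with `F` closed and away from `C`, some open `U ⊇ F` is sandwiched by test functions `1_F ≤ f ≤ 1_U
≤ g` with `n < ∫ f ∂μ` and `∫ g ∂μ < n + 1`. A nearby counting measure `N` then has `n < N U < n +
1`, which is absurd. Inner regularity by closed sets extends this to Borel sets. -/

/-- A finite extended non-negative real that lies in no gap `(n, n + 1)` is a natural number. -/
theorem ENNReal.exists_eq_natCast_of_forall_not_between {x : ENNReal} (hx : x ≠ ⊤)
    (h : ∀ n : ℕ, (n : ENNReal) < x → x < (n : ENNReal) + 1 → False) :
    ∃ n : ℕ, x = n := by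
  lift x to NNReal using hx
  refine ⟨⌊x⌋₊, ?_⟩
  by_contra hne
  have h1 : ((⌊x⌋₊ : ℕ) : NNReal) ≤ x := Nat.floor_le zero_le
  have h2 : x < (⌊x⌋₊ : NNReal) + 1 := Nat.lt_floor_add_one x
  refine h ⌊x⌋₊ (lt_of_le_of_ne ?_ (Ne.symm hne)) ?_
  · exact_mod_cast h1
  · exact_mod_cast h2

theorem ENNReal.false_of_natCast_between {x : ENNReal} (hx : ∃ m : ℕ, x = m) {n : ℕ}
    (h1 : (n : ENNReal) < x) (h2 : x < (n : ENNReal) + 1) : False := by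
  obtain ⟨m, rfl⟩ := hx
  have h1' : n < m := by exact_mod_cast h1
  have h2' : m < n + 1 := by exact_mod_cast h2
  omega

/-- The thickened indicator of a set as a bounded continuous real function. -/
noncomputable def realThickenedIndicator {X : Type*} [PseudoEMetricSpace X] {δ : ℝ}
    (hδ : 0 < δ) (E : Set X) : X →ᵇ ℝ :=
  BoundedContinuousFunction.comp _ (LipschitzWith.subtype_val _) (thickenedIndicator hδ E)

theorem realThickenedIndicator_apply {X : Type*} [PseudoEMetricSpace X] {δ : ℝ}
    (hδ : 0 < δ) (E : Set X) (x : X) :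
    realThickenedIndicator hδ E x = (thickenedIndicator hδ E x : ℝ) := rfl

theorem realThickenedIndicator_le_indicator {X : Type*} [PseudoEMetricSpace X] {δ : ℝ}
    (hδ : 0 < δ) (E : Set X) (x : X) :
    realThickenedIndicator hδ E x ≤ (Metric.thickening δ E).indicator (fun _ => (1 : ℝ)) x := by
  rw [realThickenedIndicator_apply]
  by_cases hx : x ∈ Metric.thickening δ E
  · rw [Set.indicator_of_mem hx]
    exact_mod_cast thickenedIndicator_le_one hδ E x
  · rw [Set.indicator_of_notMem hx, thickenedIndicator_zero hδ E hx]
    simp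

theorem indicator_le_realThickenedIndicator {X : Type*} [PseudoEMetricSpace X] {δ : ℝ}
    (hδ : 0 < δ) (E : Set X) (x : X) :
    E.indicator (fun _ => (1 : ℝ)) x ≤ realThickenedIndicator hδ E x := by
  rw [realThickenedIndicator_apply]
  by_cases hx : x ∈ E
  · rw [Set.indicator_of_mem hx, thickenedIndicator_one hδ E hx]
    simp
  · rw [Set.indicator_of_notMem hx]
    exact NNReal.coe_nonneg _

theorem integrable_realThickenedIndicator {X : Type*} [PseudoEMetricSpace X] [MeasurableSpace X]
    [BorelSpace X] (μ : Measure X) {δ : ℝ} (hδ : 0 < δ) (E : Set X)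
    (hfin : μ (Metric.thickening δ E) ≠ ⊤) :
    Integrable (realThickenedIndicator hδ E) μ := by
  have hint : Integrable ((Metric.thickening δ E).indicator (fun _ => (1 : ℝ))) μ :=
    (integrable_indicator_iff Metric.isOpen_thickening.measurableSet).2
      (integrableOn_const hfin)
  refine hint.mono' (realThickenedIndicator hδ E).continuous.measurable.aestronglyMeasurable
    (ae_of_all _ fun x => ?_)
  rw [realThickenedIndicator_apply, Real.norm_of_nonneg (NNReal.coe_nonneg _)]
  exact realThickenedIndicator_le_indicator hδ E x

theorem integral_realThickenedIndicator_le {X : Type*} [PseudoEMetricSpace X] [MeasurableSpace X]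
    [BorelSpace X] (μ : Measure X) {δ : ℝ} (hδ : 0 < δ) (E : Set X)
    (hfin : μ (Metric.thickening δ E) ≠ ⊤) :
    ∫ x, realThickenedIndicator hδ E x ∂μ ≤ μ.real (Metric.thickening δ E) := by
  have hm : MeasurableSet (Metric.thickening δ E) := Metric.isOpen_thickening.measurableSet
  calc ∫ x, realThickenedIndicator hδ E x ∂μ
      ≤ ∫ x, (Metric.thickening δ E).indicator (fun _ => (1 : ℝ)) x ∂μ :=
        integral_mono (integrable_realThickenedIndicator μ hδ E hfin)
          ((integrable_indicator_iff hm).2 (integrableOn_const hfin))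
          (realThickenedIndicator_le_indicator hδ E)
    _ = μ.real (Metric.thickening δ E) := integral_indicator_one hm

theorem le_integral_realThickenedIndicator {X : Type*} [PseudoEMetricSpace X] [MeasurableSpace X]
    [BorelSpace X] (μ : Measure X) {δ : ℝ} (hδ : 0 < δ) {E : Set X} (hE : MeasurableSet E)
    (hfin : μ (Metric.thickening δ E) ≠ ⊤) :
    μ.real E ≤ ∫ x, realThickenedIndicator hδ E x ∂μ := by
  have hfinE : μ E ≠ ⊤ := ne_top_of_le_ne_top hfin
    (measure_mono (Metric.self_subset_thickening hδ E))
  calc μ.real E = ∫ x, E.indicator (fun _ => (1 : ℝ)) x ∂μ := (integral_indicator_one hE).symm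
    _ ≤ ∫ x, realThickenedIndicator hδ E x ∂μ :=
        integral_mono ((integrable_indicator_iff hE).2 (integrableOn_const hfinE))
          (integrable_realThickenedIndicator μ hδ E hfin)
          (indicator_le_realThickenedIndicator hδ E)

section

variable {S : Type*} [MetricSpace S] {C : Set S}

theorem isClosed_awaySet (r : ℝ) : IsClosed (awaySet C r) :=
  (Metric.isOpen_thickening.preimage continuous_subtype_val).isClosed_compl

theorem thickening_awaySet_subset {r δ : ℝ} :
    Metric.thickening δ (awaySet C (r + δ)) ⊆ awaySet C r := by
  intro x hx hxC
  obtain ⟨y, hy, hxy⟩ := Metric.mem_thickening_iff.1 hx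
  obtain ⟨z, hz, hxz⟩ := Metric.mem_thickening_iff.1 hxC
  refine hy (Metric.mem_thickening_iff.2 ⟨z, hz, ?_⟩)
  have hxy' : dist (y : S) x < δ := by rwa [dist_comm]
  linarith [dist_triangle (y : S) x z]

theorem realThickenedIndicator_mem_testFunctions {r δ : ℝ} (hr : 0 < r) (hδ : 0 < δ)
    {E : Set ↥(Cᶜ)} (hE : Metric.thickening δ E ⊆ awaySet C r) :
    realThickenedIndicator hδ E ∈ testFunctions C := by
  refine ⟨fun x => NNReal.coe_nonneg _, r, hr, fun x hx => ?_⟩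
  rw [realThickenedIndicator_apply, thickenedIndicator_zero hδ E fun h => hE h hx]
  simp

variable [MeasurableSpace S] [BorelSpace S]

/-- Since `Cᶜ` is Borel, measurable subsets of the subtype have Borel images in `S`, to which the
definition of `NO` applies. -/
theorem measure_eq_natCast_of_mem_NO (hC : IsClosed C) {N : MO C} (hN : N ∈ NO C) {r : ℝ}
    (hr : 0 < r) {U : Set ↥(Cᶜ)} (hU : MeasurableSet U) (hUr : U ⊆ awaySet C r) :
    ∃ n : ℕ, N.1 U = n := by
  obtain ⟨n, hn⟩ := hN r hr (Subtype.val '' U)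
    (hC.measurableSet.compl.subtype_image hU)
  refine ⟨n, ?_⟩
  rw [← hn]
  congr 1
  ext x
  constructor
  · exact fun hx => ⟨⟨x, hx, rfl⟩, hUr hx⟩
  · rintro ⟨⟨y, hy, hyx⟩, -⟩
    rwa [← Subtype.ext hyx]

/-- A limit of counting measures takes integer values on closed sets away from `C`. -/
theorem measure_eq_natCast_of_isClosed (hC : IsClosed C) {μ : MO C} (hμ : μ ∈ closure (NO C))
    {r : ℝ} (hr : 0 < r) {F : Set ↥(Cᶜ)} (hF : IsClosed F) (hFr : F ⊆ awaySet C r) :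
    ∃ n : ℕ, μ.1 F = n := by
  have hfin : ∀ (ν : MO C) {U : Set ↥(Cᶜ)}, U ⊆ awaySet C (r / 2) → ν.1 U ≠ ⊤ :=
    fun ν U hU => ((measure_mono hU).trans_lt (ν.2 (r / 2) (half_pos hr))).ne
  have hthick : Metric.thickening (r / 2) F ⊆ awaySet C (r / 2) := by
    refine (Metric.thickening_subset_of_subset _ hFr).trans ?_
    have := thickening_awaySet_subset (C := C) (r := r / 2) (δ := r / 2)
    rwa [add_halves] at this
  have hsub : ∀ {ε : ℝ}, ε ≤ r / 2 → Metric.thickening ε F ⊆ awaySet C (r / 2) :=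
    fun hε => (Metric.thickening_mono hε F).trans hthick
  refine ENNReal.exists_eq_natCast_of_forall_not_between
    (ne_top_of_le_ne_top (hfin μ hthick)
      (measure_mono (Metric.self_subset_thickening (half_pos hr) F))) fun n hn hn' => ?_
  obtain ⟨ε, hε, hεr, hμε⟩ : ∃ ε : ℝ, 0 < ε ∧ ε ≤ r / 2 ∧
      μ.1 (Metric.thickening ε F) < (n : ENNReal) + 1 := by
    -- Continuity from above along the thickenings of `F`; it needs one of them to have finite
    -- measure.
    have hlim := tendsto_measure_thickening_of_isClosed (μ := μ.1)
      ⟨r / 2, half_pos hr, hfin μ hthick⟩ hF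
    obtain ⟨ε, h1, h2⟩ := ((hlim.eventually_lt_const hn').and
      (Ioc_mem_nhdsGT (half_pos hr))).exists
    exact ⟨ε, h2.1, h2.2, h1⟩
  have hε2 : 0 < ε / 2 := half_pos hε
  -- Halving `ε` leaves room for `f` between `F` and `U`, and for `g` between `U` and the
  -- `ε`-thickening.
  set U := Metric.thickening (ε / 2) F
  have hUsub : U ⊆ awaySet C (r / 2) := hsub (by linarith)
  have hUε : Metric.thickening (ε / 2) U ⊆ Metric.thickening ε F := by
    have := Metric.thickening_thickening_subset (ε / 2) (ε / 2) F
    rwa [add_halves] at this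
  have hUU : Metric.thickening (ε / 2) U ⊆ awaySet C (r / 2) := hUε.trans (hsub hεr)
  have hUm : MeasurableSet U := Metric.isOpen_thickening.measurableSet
  have hf := realThickenedIndicator_mem_testFunctions (half_pos hr) hε2 hUsub
  have hg := realThickenedIndicator_mem_testFunctions (half_pos hr) hε2 hUU
  have hμf : (n : ℝ) < ∫ x, realThickenedIndicator hε2 F x ∂μ.1 := by
    refine lt_of_lt_of_le ?_
      (le_integral_realThickenedIndicator μ.1 hε2 hF.measurableSet (hfin μ hUsub))
    rw [measureReal_def, ← ENNReal.toReal_natCast]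
    exact (ENNReal.toReal_lt_toReal (ENNReal.natCast_ne_top n) (hn'.trans_le le_top).ne).2 hn
  have hμg : ∫ x, realThickenedIndicator hε2 U x ∂μ.1 < (n : ℝ) + 1 := by
    refine (integral_realThickenedIndicator_le μ.1 hε2 U (hfin μ hUU)).trans_lt ?_
    have h1 : μ.1 (Metric.thickening (ε / 2) U) < ((n + 1 : ℕ) : ENNReal) := by
      push_cast
      exact (measure_mono hUε).trans_lt hμε
    have h2 := (ENNReal.toReal_lt_toReal (hfin μ hUU) (ENNReal.natCast_ne_top _)).2 h1
    rw [ENNReal.toReal_natCast] at h2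
    exact_mod_cast h2
  -- Both strict inequalities are open conditions at `μ`, so one `N ∈ NO C` satisfies them together.
  have hconv := MO.tendsto_iff.1 (tendsto_id (x := 𝓝 μ))
  obtain ⟨N, ⟨hNf, hNg⟩, hN⟩ := mem_closure_iff_nhds.1 hμ _
    (((hconv _ hf).eventually_const_lt hμf).and ((hconv _ hg).eventually_lt_const hμg))
  have h1 : (n : ℝ) < N.1.real U :=
    hNf.trans_le (integral_realThickenedIndicator_le N.1 hε2 F (hfin N hUsub))
  have h2 : N.1.real U < (n : ℝ) + 1 :=
    (le_integral_realThickenedIndicator N.1 hε2 hUm (hfin N hUU)).trans_lt hNg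
  obtain ⟨m, hm⟩ := measure_eq_natCast_of_mem_NO hC hN (half_pos hr) hUm hUsub
  rw [measureReal_def, hm, ENNReal.toReal_natCast] at h1 h2
  have h1' : n < m := by exact_mod_cast h1
  have h2' : m < n + 1 := by exact_mod_cast h2
  omega

end

theorem theorem2p4 {S : Type*} [MetricSpace S] [CompleteSpace S]
    [TopologicalSpace.SeparableSpace S] [MeasurableSpace S] [BorelSpace S]
    (C : Set S) (hC : IsClosed C) :
    IsClosed (NO C) := by
  refine isClosed_of_closure_subset fun μ hμ r hr A hA => ?_
  -- Restriction makes the measure finite, hence inner regular for closed sets.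
  set ν : Measure ↥(Cᶜ) := μ.1.restrict (awaySet C r) with hν
  have : IsFiniteMeasure ν := ⟨by simpa [hν] using μ.2 r hr⟩
  have hB : MeasurableSet (Subtype.val ⁻¹' A : Set ↥(Cᶜ)) := measurable_subtype_coe hA
  have heq : μ.1 {x : ↥(Cᶜ) | (x : S) ∈ A \ Metric.thickening r C} =
      ν (Subtype.val ⁻¹' A) := by
    rw [hν, Measure.restrict_apply hB]
    rfl
  rw [heq]
  refine ENNReal.exists_eq_natCast_of_forall_not_between (measure_ne_top _ _) fun n hn hn' => ?_
  obtain ⟨F, hFA, hF, hnF⟩ := hB.exists_lt_isClosed_of_ne_top (measure_ne_top ν _) hn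
  have hFn : ∃ m : ℕ, ν F = m := by
    rw [hν, Measure.restrict_apply hF.measurableSet]
    exact measure_eq_natCast_of_isClosed hC hμ hr (hF.inter (isClosed_awaySet r))
      Set.inter_subset_right
  exact ENNReal.false_of_natCast_between hFn hnF ((measure_mono hFA).trans_lt hn')
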